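/- Discretized point patrolling: let $k$ agents be given together with positive integers $a_1,\dots,a_k$. A schedule is a $k$-tuple of sets $S_1,\dots,S_k\subseteq\mathbb{Z}$, where $S_i$ is the set of times at which agent $i$ visits the point, such that $|s-t|\ge a_i$ for any two distinct $s,t\in S_i$. The tuple $(a_1,\dots,a_k)$ is called good if there is a schedule such that at every integer time the point is visited by at least one agent, i.e. $\bigcup_{i=1}^k S_i=\mathbb{Z}$. Theorem. Let $a_1,\dots,a_k$ be positive integers. If $$\sum_{i=1}^k \frac{1}{a_i} > 1.546,$$ then $(a_1,\dots,a_k)$ is good. -/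

import Mathlib

/-- A schedule for `k` agents patrolling a point in discrete time: `S i` is the set of integer
times at which agent `i` visits the point. It respects the intervals `a` if any two distinct
visits of agent `i` are at least `a i` apart. -/
def RespectsIntervals {k : ℕ} (a : Fin k → ℕ) (S : Fin k → Set ℤ) : Prop :=
  ∀ i, ∀ s ∈ S i, ∀ t ∈ S i, s ≠ t → (a i : ℤ) ≤ |s - t|

/-- A schedule is good if the point is visited by at least one agent at each integer time. -/
def IsGoodSchedule {k : ℕ} (S : Fin k → Set ℤ) : Prop :=
  ∀ t : ℤ, ∃ i, t ∈ S i

/-- The tuple `(a₁, …, aₖ)` is good if some schedule respecting these intervals is good. -/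
def IsGoodTuple {k : ℕ} (a : Fin k → ℕ) : Prop :=
  ∃ S : Fin k → Set ℤ, RespectsIntervals a S ∧ IsGoodSchedule S

/-! Fix `m` in {1, 3, 5, 7} and round every interval up to the form `m * 2 ^ j`. Periodic visits
with these periods cover ℤ once the rounded frequencies sum to at least 1: fill residue classes mod
`m` greedily, halving the leftover classes repeatedly. A single `m` may lose too much in rounding,
but a weighted average over the four keeps 90/139 of each frequency, so if all four failed, `∑ 1 / a
i` would be below 139/90 < 1.546. -/

open Finset in
/-- Every element of a finite index set `s` can pick an element of `R` so that as many elements of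
`R` as possible are picked. -/
theorem exists_card_sdiff_image_le {ι : Type*} [DecidableEq ι] (R : Finset ℤ) (s : Finset ι) :
    ∃ g : ι → ℤ, (R \ s.image g).card ≤ R.card - s.card := by
  induction s using Finset.induction_on with
  | empty => exact ⟨fun _ => 0, by simp⟩
  | insert x s hx ih =>
    obtain ⟨g, hg⟩ := ih
    have key (y : ℤ) : (insert x s).image (Function.update g x y) = insert y (s.image g) := by
      rw [image_insert, Function.update_self]
      congr 1
      refine image_congr fun i hi => Function.update_of_ne ?_ _ _
      rintro rfl
      exact hx hi
    rcases (R \ s.image g).eq_empty_or_nonempty with he | ⟨y, hy⟩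
    · refine ⟨Function.update g x 0, ?_⟩
      rw [key, sdiff_insert, he]
      simp
    · refine ⟨Function.update g x y, ?_⟩
      rw [key, sdiff_insert, card_erase_of_mem hy, card_insert_of_notMem hx]
      omega

open Finset in
/-- If `∑ 2^(-j i) ≥ |R|`, then the residue classes of the elements of `R` modulo `q` can be covered
by one residue class modulo `q * 2 ^ j i` for each `i`. -/
theorem exists_residues_cover {ι : Type*} [DecidableEq ι] (J : ℕ) :
    ∀ (q : ℤ) (R : Finset ℤ) (s : Finset ι) (j : ι → ℕ), (∀ i ∈ s, j i < J) →
      (R.card : ℝ) ≤ ∑ i ∈ s, 1 / 2 ^ j i →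
      ∃ r : ι → ℤ, ∀ t, (∃ ρ ∈ R, q ∣ t - ρ) → ∃ i ∈ s, q * 2 ^ j i ∣ t - r i := by
  induction J with
  | zero =>
    intro q R s j hj hR
    have hs : s = ∅ := eq_empty_of_forall_notMem fun i hi => absurd (hj i hi) (Nat.not_lt_zero _)
    subst hs
    have hR0 : R = ∅ := by
      rw [← card_eq_zero]
      simpa using hR
    subst hR0
    exact ⟨fun _ => 0, fun t ⟨ρ, h, _⟩ => absurd h (notMem_empty ρ)⟩
  | succ J ih =>
    intro q R s j hj hR
    -- Indices with `j i = 0` each absorb a whole class mod `q`; `R₁` is what remains.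
    obtain ⟨g, hg⟩ := exists_card_sdiff_image_le R (s.filter fun i => j i = 0)
    set s₀ := s.filter fun i => j i = 0
    set s₁ := s.filter fun i => ¬ j i = 0
    set R₁ := R \ s₀.image g
    have hsum : (R.card : ℝ) ≤ s₀.card + ∑ i ∈ s₁, 1 / 2 ^ j i := by
      rw [← sum_filter_add_sum_filter_not s (fun i => j i = 0)] at hR
      refine hR.trans_eq ?_
      congr 1
      rw [card_eq_sum_ones, Nat.cast_sum]
      refine sum_congr rfl fun i hi => ?_
      rw [(mem_filter.1 hi).2]
      simp
    have hhalf : ∑ i ∈ s₁, (1 : ℝ) / 2 ^ (j i - 1) = 2 * ∑ i ∈ s₁, 1 / 2 ^ j i := by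
      rw [mul_sum]
      refine sum_congr rfl fun i hi => ?_
      obtain ⟨n, hn⟩ := Nat.exists_eq_succ_of_ne_zero (mem_filter.1 hi).2
      rw [hn, Nat.succ_sub_one, Nat.succ_eq_add_one, pow_succ]
      field_simp
    have hnonneg : (0 : ℝ) ≤ ∑ i ∈ s₁, 1 / 2 ^ j i := sum_nonneg fun i _ => by positivity
    have hR₁ : (R₁.card : ℝ) ≤ ∑ i ∈ s₁, 1 / 2 ^ j i := by
      rcases le_total s₀.card R.card with h | h
      · have : (R₁.card : ℝ) ≤ R.card - s₀.card := by
          rw [← Nat.cast_sub h]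
          exact_mod_cast hg
        linarith
      · have : R₁.card = 0 := by omega
        rw [this, Nat.cast_zero]
        exact hnonneg
    -- A class mod `q` splits into two mod `2 * q`; lowering each exponent by 1 doubles the sum to
    -- match.
    have hcard : (R₁ ∪ R₁.image (· + q)).card ≤ 2 * R₁.card := by
      have h₁ := card_union_le R₁ (R₁.image (· + q))
      have h₂ : (R₁.image (· + q)).card ≤ R₁.card := card_image_le
      omega
    obtain ⟨r, hr⟩ := ih (q * 2) (R₁ ∪ R₁.image (· + q)) s₁ (fun i => j i - 1)
      (fun i hi => by
        have h₁ := hj i (mem_filter.1 hi).1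
        have h₂ := (mem_filter.1 hi).2
        omega)
      (by
        have : ((R₁ ∪ R₁.image (· + q)).card : ℝ) ≤ 2 * R₁.card := by exact_mod_cast hcard
        rw [hhalf]
        linarith)
    refine ⟨fun i => if j i = 0 then g i else r i, fun t ⟨ρ, hρ, hdvd⟩ => ?_⟩
    by_cases hρ₁ : ρ ∈ s₀.image g
    · obtain ⟨i, hi, rfl⟩ := mem_image.1 hρ₁
      have h₀ := (mem_filter.1 hi).2
      exact ⟨i, (mem_filter.1 hi).1, by simpa [h₀] using hdvd⟩
    · have hmem : ρ ∈ R₁ := mem_sdiff.2 ⟨hρ, hρ₁⟩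
      have hex : ∃ σ ∈ R₁ ∪ R₁.image (· + q), q * 2 ∣ t - σ := by
        obtain ⟨c, hc⟩ := hdvd
        rcases Int.even_or_odd' c with ⟨d, rfl | rfl⟩
        · exact ⟨ρ, mem_union_left _ hmem, d, by rw [hc]; ring⟩
        · exact ⟨ρ + q, mem_union_right _ (mem_image_of_mem _ hmem), d, by linear_combination hc⟩
      obtain ⟨i, hi, hdiv⟩ := hr t hex
      have h₀ := (mem_filter.1 hi).2
      refine ⟨i, (mem_filter.1 hi).1, ?_⟩
      obtain ⟨n, hn⟩ := Nat.exists_eq_succ_of_ne_zero h₀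
      simp only [hn, Nat.succ_eq_add_one, Nat.add_sub_cancel] at hdiv
      simp only [hn, Nat.succ_eq_add_one, Nat.succ_ne_zero, if_false]
      rwa [pow_succ', ← mul_assoc]

/-- Agents whose intervals are at most `m * 2 ^ j i` can patrol the point
if `∑ 1 / (m * 2 ^ j i) ≥ 1`. -/
theorem isGoodTuple_of_le_mul_two_pow {k : ℕ} {a : Fin k → ℕ} {m : ℕ} (hm : 0 < m)
    (j : Fin k → ℕ) (ha : ∀ i, a i ≤ m * 2 ^ j i) (hsum : (m : ℝ) ≤ ∑ i, 1 / 2 ^ j i) :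
    IsGoodTuple a := by
  obtain ⟨J, hJ⟩ : ∃ J, ∀ i ∈ Finset.univ, j i < J :=
    ⟨Finset.univ.sup j + 1, fun i hi => Nat.lt_succ_of_le (Finset.le_sup hi)⟩
  obtain ⟨r, hr⟩ := exists_residues_cover J (m : ℤ) (Finset.Ico 0 (m : ℤ)) Finset.univ j hJ
    (by simpa using hsum)
  refine ⟨fun i => {t | (m : ℤ) * 2 ^ j i ∣ t - r i}, fun i s hs t ht hst => ?_, fun t => ?_⟩
  · have hdvd : (m : ℤ) * 2 ^ j i ∣ |s - t| := by
      rw [dvd_abs, ← sub_sub_sub_cancel_right s t (r i)]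
      exact dvd_sub hs ht
    refine le_trans ?_ (Int.le_of_dvd (abs_pos.2 (sub_ne_zero.2 hst)) hdvd)
    exact_mod_cast ha i
  · have hm' : (0 : ℤ) < m := by exact_mod_cast hm
    obtain ⟨i, -, hi⟩ := hr t ⟨t % m,
      Finset.mem_Ico.2 ⟨Int.emod_nonneg _ hm'.ne', Int.emod_lt_of_pos _ hm'⟩,
      Int.dvd_self_sub_emod⟩
    exact ⟨i, hi⟩

/-- Rounding an interval `a ≥ 2` up to the forms `2 ^ j`, `3 * 2 ^ j`, `5 * 2 ^ j` and `7 * 2 ^ j`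
keeps at least `90 / 139` of its frequency on a suitable weighted average. -/
theorem exists_two_pow_roundings (a : ℕ) (ha : 2 ≤ a) : ∃ j₁ j₃ j₅ j₇ : ℕ,
    a ≤ 1 * 2 ^ j₁ ∧ a ≤ 3 * 2 ^ j₃ ∧ a ≤ 5 * 2 ^ j₅ ∧ a ≤ 7 * 2 ^ j₇ ∧
    90 * (1 / (a : ℝ)) ≤ 44 * (1 / 2 ^ j₁) + 12 * (1 / 2 ^ j₃) + 9 * (1 / 2 ^ j₅)
      + 2 * (1 / 2 ^ j₇) := by
  rcases Nat.lt_or_ge 8 a with h8 | h8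
  · obtain ⟨n, hn₁, hn₂⟩ : ∃ n, 8 * 2 ^ n < a ∧ a ≤ 16 * 2 ^ n := by
      -- Using `a - 1` makes the lower bound strict and keeps `a = 16 * 2 ^ n` in the range.
      have hne : (a - 1) / 8 ≠ 0 := by omega
      have h₁ := Nat.pow_log_le_self 2 hne
      have h₂ := Nat.lt_pow_succ_log_self one_lt_two ((a - 1) / 8)
      rw [pow_succ] at h₂
      exact ⟨Nat.log 2 ((a - 1) / 8), by omega, by omega⟩
    have hp : (0 : ℝ) < 2 ^ n := by positivity
    have bound (c : ℝ) (hc : 0 < c) (h : c * 2 ^ n ≤ a) :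
        90 * (1 / (a : ℝ)) ≤ 90 / c * (1 / 2 ^ n) := by
      rw [div_mul_div_comm, mul_one, mul_one_div]
      exact div_le_div_of_nonneg_left (by norm_num) (by positivity) h
    have hinv : (0 : ℝ) < 1 / 2 ^ n := by positivity
    have hpow (e : ℕ) : (1 : ℝ) / 2 ^ (n + e) = 1 / 2 ^ e * (1 / 2 ^ n) := by
      rw [pow_add]
      field_simp
    -- The roundings jump at 10 = 5·2, 12 = 3·4 and 14 = 7·2. The worst case is the left endpoint of
    -- each range; the weights 44, 12, 9, 2 give equality there for the first three.
    by_cases h10 : a ≤ 10 * 2 ^ n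
    · have := bound 8 (by norm_num) (by exact_mod_cast hn₁.le)
      refine ⟨n + 4, n + 2, n + 1, n + 1, ?_, ?_, ?_, ?_, ?_⟩
      iterate 4 rw [pow_add]; omega
      rw [hpow, hpow, hpow]
      linarith
    by_cases h12 : a ≤ 12 * 2 ^ n
    · have := bound 10 (by norm_num) (by exact_mod_cast (not_le.1 h10).le)
      refine ⟨n + 4, n + 2, n + 2, n + 1, ?_, ?_, ?_, ?_, ?_⟩
      iterate 4 rw [pow_add]; omega
      rw [hpow, hpow, hpow]
      linarith
    by_cases h14 : a ≤ 14 * 2 ^ n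
    · have := bound 12 (by norm_num) (by exact_mod_cast (not_le.1 h12).le)
      refine ⟨n + 4, n + 3, n + 2, n + 1, ?_, ?_, ?_, ?_, ?_⟩
      iterate 4 rw [pow_add]; omega
      rw [hpow, hpow, hpow, hpow]
      linarith
    · have := bound 14 (by norm_num) (by exact_mod_cast (not_le.1 h14).le)
      refine ⟨n + 4, n + 3, n + 2, n + 2, ?_, ?_, ?_, ?_, ?_⟩
      iterate 4 rw [pow_add]; omega
      rw [hpow, hpow, hpow]
      linarith
  · interval_cases a
    · exact ⟨1, 0, 0, 0, by norm_num⟩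
    · exact ⟨2, 0, 0, 0, by norm_num⟩
    · exact ⟨2, 1, 0, 0, by norm_num⟩
    · exact ⟨3, 1, 0, 0, by norm_num⟩
    · exact ⟨3, 1, 1, 0, by norm_num⟩
    · exact ⟨3, 2, 1, 0, by norm_num⟩
    · exact ⟨3, 2, 1, 1, by norm_num⟩

/-- A tuple containing the interval `1` is good. -/
theorem isGoodTuple_of_eq_one {k : ℕ} {a : Fin k → ℕ} (i₀ : Fin k) (h : a i₀ = 1) :
    IsGoodTuple a := by
  refine ⟨fun i => {_t | i = i₀}, fun i s hs t _ hst => ?_, fun t => ⟨i₀, rfl⟩⟩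
  obtain rfl : i = i₀ := hs
  rw [h]
  exact Int.one_le_abs (sub_ne_zero.2 hst)

theorem mainTheorem2 (k : ℕ) (a : Fin k → ℕ) (ha : ∀ i, 0 < a i)
    (hsum : (1.546 : ℝ) < ∑ i, 1 / (a i : ℝ)) : IsGoodTuple a := by
  -- The interval 1 is set apart because the weighted rounding bound fails there: 90 > 44 + 12 + 9 +
  -- 2.
  by_cases h1 : ∃ i, a i = 1
  · obtain ⟨i, hi⟩ := h1
    exact isGoodTuple_of_eq_one i hi
  have h2 (i : Fin k) : 2 ≤ a i := by
    have := ha i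
    have : a i ≠ 1 := fun h => h1 ⟨i, h⟩
    omega
  choose j₁ j₃ j₅ j₇ l₁ l₃ l₅ l₇ hle using fun i => exists_two_pow_roundings (a i) (h2 i)
  by_contra hbad
  have b₁ := not_le.1 fun h => hbad (isGoodTuple_of_le_mul_two_pow (by norm_num) j₁ l₁ h)
  have b₃ := not_le.1 fun h => hbad (isGoodTuple_of_le_mul_two_pow (by norm_num) j₃ l₃ h)
  have b₅ := not_le.1 fun h => hbad (isGoodTuple_of_le_mul_two_pow (by norm_num) j₅ l₅ h)
  have b₇ := not_le.1 fun h => hbad (isGoodTuple_of_le_mul_two_pow (by norm_num) j₇ l₇ h)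
  -- The four failures bound the weighted total by 44·1 + 12·3 + 9·5 + 2·7 = 139.
  have htotal := Finset.sum_le_sum fun i (_ : i ∈ Finset.univ) => hle i
  simp only [Finset.sum_add_distrib, ← Finset.mul_sum] at htotal
  norm_num at hsum b₁ b₃ b₅ b₇ htotal
  linarith
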